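/- All matroids are finite. For a matroid $M$ with ground set $E$ and rank function $r$ put $\lambda_M(X)=r(X)+r(E-X)-r(M)$ for $X\subseteq E$; for $k\ge 1$, an exact $k$-separation of $M$ is a partition $(A,B)$ of $E$ with $|A|\ge k$, $|B|\ge k$ and $\lambda_M(A)=k-1$. A matroid is simple (cosimple) if every circuit (cocircuit) has at least three elements; a triangle (triad) is a three-element circuit (cocircuit). A simple single-element extension of $N$ by $e$ is a simple matroid $M$ with $M\setminus e=N$ in which $e$ is not a coloop; a cosimple single-element coextension of $N$ by $f$ is a cosimple matroid $M$ with $M/f=N$ in which $f$ is not a loop. Theorem 2.2. Let $\mathcal{M}$ be a class of matroids closed under minors and isomorphism. Let $N\in\mathcal{M}$ be simple and cosimple, with an exact $k$-separation $(A,B)$ such that $A$ is a union of circuits of $N$ and also a union of cocircuits of $N$. Suppose that for all $M\in\mathcal{M}$: (i) If $M$ is a simple single-element extension of $N$ by $e$, then $M$ has a circuit $C_e$ with $e\in C_e$ and $C_e\subseteq A\cup\{e\}$ or $C_e\subseteq B\cup\{e\}$. (ii) If $M$ is a cosimple single-element coextension of $N$ by $f$, then $M$ has a cocircuit $D_f$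 with $f\in D_f$ and $D_f\subseteq A\cup\{f\}$ or $D_f\subseteq B\cup\{f\}$. (iii) Suppose that $M$ is a cosimple single-element coextension by $f$ of a simple single-element extension of $N$ by $e$, or a simple single-element extension by $e$ of a cosimple single-element coextension of $N$ by $f$, and let $\{e,f\}\subseteq R\subseteq B\cup\{e,f\}$. (a) If $R$ is a circuit of $M$, then $M$ has a cocircuit $D_f$ with $f\in D_f\subseteq B\cup\{e,f\}$, or there is $g\in A$ such that $\{e,f,g\}$ is a triad of $M$. (b) If $R$ is a cocircuit of $M$, then $M$ has a circuit $C_e$ with $e\in C_e\subseteq B\cup\{e,f\}$, or there is $g\in A$ such that $\{e,f,g\}$ is a triangle of $M$. Then $N$ is a $k$-decomposer, with inducer $(A,B)$, for every matroid in $\mathcal{M}$ with an $N$-minor: whenever $M\in\mathcal{M}$ has a minor $N'$ and $\varphi\colon N\to N'$ is an isomorphism, $M$ has an exact $k$-separation $(X,Y)$ with $\varphi(A)\subseteq X$ and $\varphi(B)\subseteq Y$ (in particular $A\subseteq X$ and $B\subseteq Y$ when $N$ itself is a minor of $M$). -/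

import Mathlib

open Set

namespace Matroid

variable {α : Type*}

/-- The connectivity function `λ(X) = r(X) + r(E - X) - r(M)` of a (finite) matroid,
as an integer. -/
noncomputable def connectivity (M : Matroid α) (X : Set α) : ℤ :=
  ((M.eRk X).toNat : ℤ) + ((M.eRk (M.E \ X)).toNat : ℤ) - (M.eRank.toNat : ℤ)

/-- `(A, B)` is an exact `k`-separation of `M`: a partition of the ground set with
`|A| ≥ k`, `|B| ≥ k` and `λ(A) = k - 1`, where `k ≥ 1`. -/
structure IsExactSeparation (M : Matroid α) (k : ℕ) (A B : Set α) : Prop where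
  one_le : 1 ≤ k
  union_eq : A ∪ B = M.E
  disjoint : Disjoint A B
  le_left : k ≤ A.ncard
  le_right : k ≤ B.ncard
  connectivity_eq : M.connectivity A = (k : ℤ) - 1

/-- `M` is simple: it has no circuit with at most two elements. -/
def IsSimple (M : Matroid α) : Prop :=
  ∀ C, M.IsCircuit C → 3 ≤ C.encard

/-- `M` is cosimple: it has no cocircuit with at most two elements. -/
def IsCosimple (M : Matroid α) : Prop :=
  ∀ D, M.IsCocircuit D → 3 ≤ D.encard

/-- A triangle is a three-element circuit. -/
def IsTriangle (M : Matroid α) (T : Set α) : Prop :=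
  M.IsCircuit T ∧ T.encard = 3

/-- A triad is a three-element cocircuit. -/
def IsTriad (M : Matroid α) (T : Set α) : Prop :=
  M.IsCocircuit T ∧ T.encard = 3

/-- `X` is a union of circuits of `M`. -/
def IsUnionOfCircuits (M : Matroid α) (X : Set α) : Prop :=
  ∃ 𝒞 : Set (Set α), (∀ C ∈ 𝒞, M.IsCircuit C) ∧ X = ⋃₀ 𝒞

/-- `X` is a union of cocircuits of `M`. -/
def IsUnionOfCocircuits (M : Matroid α) (X : Set α) : Prop :=
  ∃ 𝒟 : Set (Set α), (∀ D ∈ 𝒟, M.IsCocircuit D) ∧ X = ⋃₀ 𝒟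

/-- `M` is a simple single-element extension of `N` by the element `e`: `M` is simple and
`M ＼ e = N`, where `e` is not a coloop of `M`. -/
structure IsSimpleExtension (M N : Matroid α) (e : α) : Prop where
  mem_ground : e ∈ M.E
  delete_eq : M ＼ {e} = N
  not_isColoop : ¬ M.IsColoop e
  isSimple : M.IsSimple

/-- `M` is a cosimple single-element coextension of `N` by the element `f`: `M` is cosimple and
`M ／ f = N`, where `f` is not a loop of `M`. -/
structure IsCosimpleCoextension (M N : Matroid α) (f : α) : Prop where
  mem_ground : f ∈ M.E
  contract_eq : M ／ {f} = N
  not_isLoop : ¬ M.IsLoop f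
  isCosimple : M.IsCosimple

/-- `M` is a cosimple single-element coextension, by `f`, of a simple single-element extension of
`N` by `e`, or a simple single-element extension, by `e`, of a cosimple single-element coextension
of `N` by `f`. In both cases `M ＼ e ／ f = N`. -/
def IsTwoElementExpansion (M N : Matroid α) (e f : α) : Prop :=
  (∃ M₁ : Matroid α, M₁.IsSimpleExtension N e ∧ M.IsCosimpleCoextension M₁ f) ∨
  (∃ M₂ : Matroid α, M₂.IsCosimpleCoextension N f ∧ M.IsSimpleExtension M₂ e)

/-- A class of finite matroids (with elements taken from `α`) that is closed under taking minors
and under isomorphism, i.e. under relabelling the elements by an injective map. -/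
structure IsClosedClass (𝓜 : Set (Matroid α)) : Prop where
  finite : ∀ M ∈ 𝓜, M.E.Finite
  minor : ∀ M ∈ 𝓜, ∀ N : Matroid α, N ≤m M → N ∈ 𝓜
  iso : ∀ M ∈ 𝓜, ∀ (φ : α → α) (hφ : InjOn φ M.E), M.map φ hφ ∈ 𝓜

/-- `N` is a `k`-decomposer for `M` having `(A, B)` as an inducer. For every minor of `M` that is
a copy of `N` (`N` relabelled by `φ`, in particular `N` itself if it is a minor of `M`) there is an
exact `k`-separation `(X, Y)` of `M` such that `X` and `Y` contain the copies of `A` and `B`. -/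
def IsDecomposer (N : Matroid α) (k : ℕ) (A B : Set α) (M : Matroid α) : Prop :=
  ∀ (φ : α → α) (hφ : InjOn φ N.E), N.map φ hφ ≤m M →
    ∃ X Y : Set α, M.IsExactSeparation k X Y ∧ φ '' A ⊆ X ∧ φ '' B ⊆ Y

/-- `M` has an `N`-minor: a minor that is isomorphic to `N`. -/
def HasMinorCopy (M N : Matroid α) : Prop :=
  ∃ (φ : α → α) (hφ : InjOn φ N.E), N.map φ hφ ≤m M

end Matroid

/-! Take a counterexample `M` with `|E(M)|` minimal over all relabelled copies of `N`, and relabel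
so that `N = M ／ C ＼ D` with `C` independent and `D` coindependent. Smaller members of the class do
separate `A` from `B`, and submodularity uncrosses their separations. Hence at most one `e ∈ D` lies
outside `cl(B ∪ C)` (`eq_of_notMem_closure`), dually at most one `f ∈ C` lies outside `cl*(B ∪ D)`,
and the two cannot coexist (`mem_closure_or_mem_dual_closure`). All hypotheses are self-dual, so it
may be assumed that `D ⊆ cl(B ∪ C)` and that at most one `f ∈ C` lies in `cl(A ∪ (C \ f))`.

If there is no such `f`, a rank count gives `λ(A) = k - 1`. Otherwise (ii) yields `f ∉ cl(B ∪ (C \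
f))`, and the same count for `A ∪ f` can fail only if some `e ∈ D` is outside `cl(B ∪ (C \ f))`
(`exists_notMem_closure`). In the minor of `M` on `E(N) ∪ {e, f}`, condition (iii)(a) then forces a
triad `{e, f, g}` with `g ∈ A`. Deleting `e` puts `f` and `g` in series, so exchanging them gives a
copy of `N` in `M ／ g`. The separation of `M ／ g` for that copy lifts to `M` unless `g ∈ cl_N(B)`,
which is impossible because `A` is a union of cocircuits (`false_of_isTriad`). -/

namespace Matroid

/-! ### Integer-valued rank and the connectivity function. -/

section Rank

variable {α : Type*} {M N : Matroid α} {X Y C D A B S : Set α} {e f : α}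

/-- The rank of a set as an integer (meaningful for matroids of finite rank). -/
noncomputable def rk (M : Matroid α) (X : Set α) : ℤ := ((M.eRk X).toNat : ℤ)

lemma connectivity_eq_rk (M : Matroid α) (X : Set α) :
    M.connectivity X = M.rk X + M.rk (M.E \ X) - M.rk M.E := by
  simp [connectivity, rk]

lemma coe_toNat_eRk (M : Matroid α) [M.RankFinite] (X : Set α) :
    ((M.eRk X).toNat : ℕ∞) = M.eRk X :=
  ENat.natCast_toNat (eRk_ne_top_iff.2 (M.isRkFinite_set X))

lemma rk_inter_ground (M : Matroid α) (X : Set α) : M.rk (X ∩ M.E) = M.rk X := by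
  simp [rk]

lemma rk_mono (M : Matroid α) [M.RankFinite] (h : X ⊆ Y) : M.rk X ≤ M.rk Y := by
  have := M.eRk_mono h
  rw [← M.coe_toNat_eRk X, ← M.coe_toNat_eRk Y] at this
  unfold rk
  exact_mod_cast this

lemma rk_inter_add_rk_union_le (M : Matroid α) [M.RankFinite] (X Y : Set α) :
    M.rk (X ∩ Y) + M.rk (X ∪ Y) ≤ M.rk X + M.rk Y := by
  have := M.eRk_inter_add_eRk_union_le X Y
  rw [← M.coe_toNat_eRk X, ← M.coe_toNat_eRk Y, ← M.coe_toNat_eRk (X ∩ Y),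
    ← M.coe_toNat_eRk (X ∪ Y)] at this
  unfold rk
  exact_mod_cast this

lemma rk_nonneg (M : Matroid α) (X : Set α) : 0 ≤ M.rk X := by
  simp [rk]

lemma rk_union_le (M : Matroid α) [M.RankFinite] (X Y : Set α) :
    M.rk (X ∪ Y) ≤ M.rk X + M.rk Y := by
  linarith [M.rk_inter_add_rk_union_le X Y, M.rk_nonneg (X ∩ Y)]

lemma rk_singleton_le (M : Matroid α) [M.RankFinite] (e : α) : M.rk {e} ≤ 1 := by
  have := M.eRk_singleton_le e
  rw [← M.coe_toNat_eRk] at this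
  unfold rk
  exact_mod_cast this

lemma rk_insert_of_notMem_closure [M.RankFinite] (heE : e ∈ M.E) (he : e ∉ M.closure X) :
    M.rk (insert e X) = M.rk X + 1 := by
  have := M.eRk_insert_eq_add_one ⟨heE, he⟩
  rw [← M.coe_toNat_eRk X, ← M.coe_toNat_eRk (insert e X)] at this
  unfold rk
  exact_mod_cast this

lemma rk_congr_closure (h : M.closure X = M.closure Y) : M.rk X = M.rk Y := by
  rw [rk, rk, ← eRk_closure_eq, h, eRk_closure_eq]

lemma rk_insert_of_mem_closure (he : e ∈ M.closure X) : M.rk (insert e X) = M.rk X :=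
  rk_congr_closure (closure_insert_eq_of_mem_closure he)

lemma mem_closure_of_rk_insert_le [M.RankFinite] (heE : e ∈ M.E)
    (h : M.rk (insert e X) ≤ M.rk X) : e ∈ M.closure X := by
  by_contra he
  linarith [rk_insert_of_notMem_closure heE he]

lemma rk_union_of_subset_closure (h : Y ⊆ M.closure X) : M.rk (X ∪ Y) = M.rk X := by
  rw [rk, rk, ← eRk_union_closure_left_eq, union_eq_self_of_subset_right h, eRk_closure_eq]

lemma Indep.rk_eq [M.Finite] (h : M.Indep X) : M.rk X = X.ncard := by
  rw [rk, h.eRk_eq_encard]; rfl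

lemma rk_delete (M : Matroid α) (X D : Set α) : (M ＼ D).rk X = M.rk (X \ D) := by
  rw [rk, delete_eq_restrict, restrict_eRk_eq', rk, ← eRk_inter_ground M (X \ D)]
  congr 3
  grind

lemma rk_dual [M.Finite] (hX : X ⊆ M.E) :
    M✶.rk X + M.rk M.E = M.rk (M.E \ X) + X.ncard := by
  have := M.eRk_dual_add_eRank X hX
  rw [← eRk_ground, ← (M.ground_finite.subset hX).cast_ncard_eq] at this
  rw [← coe_toNat_eRk, ← M.coe_toNat_eRk M.E, ← M.coe_toNat_eRk (M.E \ X)] at this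
  unfold rk
  exact_mod_cast this

/-- Contraction is deletion in the dual, so the formula comes from the corank formula used once in
`M✶ ＼ C` and twice in `M`. -/
lemma rk_contract_of_subset [M.Finite] (hC : C ⊆ M.E) (hX : X ⊆ M.E \ C) :
    (M ／ C).rk X = M.rk (X ∪ C) - M.rk C := by
  have hXE := hX.trans sdiff_subset
  have h1 := rk_dual (M := M✶ ＼ C) (X := X) hX
  have h2 := rk_dual (M := M) (X := M.E \ (X ∪ C)) sdiff_subset
  have h3 := rk_dual (M := M) (X := M.E \ C) sdiff_subset
  rw [sdiff_sdiff_cancel_left (union_subset hXE hC)] at h2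
  rw [sdiff_sdiff_cancel_left hC] at h3
  rw [dual_delete_dual, rk_delete, rk_delete, delete_ground, dual_ground,
    show ((M.E \ C) \ X) \ C = M.E \ (X ∪ C) by grind, show (M.E \ C) \ C = M.E \ C by grind] at h1
  have h4 : ((M.E \ C).ncard : ℤ) = (M.E \ (X ∪ C)).ncard + X.ncard := by
    rw [← Nat.cast_add, ← ncard_union_eq (by grind)
      (M.ground_finite.subset sdiff_subset) (M.ground_finite.subset hXE)]
    congr 2
    grind
  linarith

lemma rk_contract [M.Finite] (hC : C ⊆ M.E) (X : Set α) :
    (M ／ C).rk X = M.rk (X ∪ C) - M.rk C := by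
  rw [← rk_inter_ground, contract_ground, rk_contract_of_subset hC inter_subset_right,
    ← rk_inter_ground M (X ∪ C), ← rk_inter_ground M (X ∩ (M.E \ C) ∪ C)]
  congr 2
  grind

lemma connectivity_dual (M : Matroid α) [M.Finite] (X : Set α) :
    M✶.connectivity X = M.connectivity X := by
  have h : ∀ (M : Matroid α) (X : Set α), M.connectivity X = M.connectivity (X ∩ M.E) := by
    intro M X
    rw [connectivity_eq_rk, connectivity_eq_rk, rk_inter_ground, sdiff_inter_self_eq_sdiff]
  rw [h, h M, dual_ground]
  have hX : X ∩ M.E ⊆ M.E := inter_subset_right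
  set Z := X ∩ M.E
  have h1 := rk_dual hX
  have h2 := rk_dual (M := M) (X := M.E \ Z) sdiff_subset
  have h3 := rk_dual (M := M) (X := M.E) subset_rfl
  rw [sdiff_sdiff_cancel_left hX] at h2
  have h4 : (M.E.ncard : ℤ) = (M.E \ Z).ncard + Z.ncard := by
    rw [← Nat.cast_add, ncard_sdiff_add_ncard_of_subset hX M.ground_finite]
  have h5 : M.rk (M.E \ M.E) = 0 := by simp [rk]
  rw [connectivity_eq_rk, connectivity_eq_rk, dual_ground]
  linarith

lemma connectivity_contract_le (M : Matroid α) [M.Finite] (hC : C ⊆ M.E) (X : Set α) :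
    (M ／ C).connectivity X ≤ M.connectivity X := by
  rw [connectivity_eq_rk, connectivity_eq_rk, rk_contract hC, rk_contract hC, rk_contract hC,
    contract_ground]
  have h1 := M.rk_inter_add_rk_union_le X C
  have h2 := M.rk_union_le (M.E \ X) (X ∩ C)
  rw [show (M.E \ C) \ X ∪ C = M.E \ X ∪ X ∩ C by grind, sdiff_union_of_subset hC]
  linarith

lemma connectivity_delete_le (M : Matroid α) [M.Finite] (hD : D ⊆ M.E) (X : Set α) :
    (M ＼ D).connectivity X ≤ M.connectivity X := by
  rw [← connectivity_dual, ← connectivity_dual M, dual_delete]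
  exact connectivity_contract_le M✶ hD X

lemma IsMinor.connectivity_le [M.Finite] (h : N ≤m M) (X : Set α) :
    N.connectivity X ≤ M.connectivity X := by
  obtain ⟨C, D, hC, hD, hdj, rfl⟩ := h.exists_eq_contract_delete_disjoint
  exact (connectivity_delete_le _ (subset_sdiff.2 ⟨hD, hdj.symm⟩) X).trans
    (connectivity_contract_le _ hC X)

lemma connectivity_congr (h : X ∩ M.E = Y ∩ M.E) : M.connectivity X = M.connectivity Y := by
  rw [connectivity_eq_rk, connectivity_eq_rk, ← rk_inter_ground, h, rk_inter_ground,
    ← sdiff_inter_self_eq_sdiff, h, sdiff_inter_self_eq_sdiff]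

lemma rk_union_eq_add_ncard [M.Finite] {Z : Set α} (hS : S ⊆ M.E)
    (h : ∀ c ∈ S, c ∉ M.closure (Z ∪ (S \ {c}))) : M.rk (Z ∪ S) = M.rk Z + S.ncard := by
  have hfin := M.ground_finite.subset hS
  suffices ∀ T ⊆ S, M.rk (Z ∪ T) = M.rk Z + T.ncard from this S subset_rfl
  intro T hT
  induction T, hfin.subset hT using Set.Finite.induction_on with
  | empty => simp
  | @insert c T hcT hTfin ih =>
    rw [insert_subset_iff] at hT
    rw [union_insert, rk_insert_of_notMem_closure (hS hT.1), ih hT.2, ncard_insert_of_notMem hcT hTfin]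
    · push_cast; ring
    · exact fun hc ↦ h c hT.1 (M.closure_subset_closure (by grind) hc)

end Rank

/-! ### Minors, closure in minors and closure in the dual. -/

section Minor

variable {α : Type*} {M N : Matroid α} {X Y C D C' D' A B S : Set α} {e f : α}

lemma IsMinor.finite [M.Finite] (h : N ≤m M) : N.Finite := by
  obtain ⟨C, D, rfl⟩ := h
  infer_instance

lemma IsMinor.dual (h : N ≤m M) : N✶ ≤m M✶ := by
  obtain ⟨C, D, hC, hD, hdj, rfl⟩ := h.exists_eq_contract_delete_disjoint
  rw [dual_contract_delete, ← contract_delete_comm _ hdj.symm]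
  exact contract_delete_isMinor ..

/-- Once a basis `I` of `C` is contracted, `C \ I` consists of loops and can be deleted instead.
Dually, once a cobasis `J` of the resulting deleted set is deleted, the rest of that set consists of
coloops and can be contracted. -/
lemma IsMinor.exists_indep_coindep (h : N ≤m M) :
    ∃ C D, M.Indep C ∧ M.Coindep D ∧ Disjoint C D ∧ M ／ C ＼ D = N := by
  obtain ⟨C, D, hC, hD, hdj, rfl⟩ := h.exists_eq_contract_delete_disjoint
  obtain ⟨I, hI⟩ := M.exists_isBasis C
  have hID : Disjoint (C \ I ∪ D) I :=
    disjoint_union_left.2 ⟨disjoint_sdiff_left, (hdj.mono_left hI.subset).symm⟩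
  obtain ⟨J, hJ⟩ := M✶.exists_isBasis (C \ I ∪ D) (union_subset (sdiff_subset.trans hC) hD)
  have hJI : Disjoint J I := hID.mono_left hJ.subset
  refine ⟨(C \ I ∪ D) \ J ∪ I, J, ?_, hJ.indep, ?_, ?_⟩
  · have h1 : (C \ I ∪ D) \ J ⊆ (M ＼ J).coloops := by
      rw [← dual_loops, dual_delete]
      exact hJ.sdiff_subset_loops_contract
    have h2 : (M ＼ J).Indep (I ∪ (C \ I ∪ D) \ J) := by
      rw [union_indep_iff_indep_of_subset_coloops h1]
      exact hI.indep.indep_delete_of_disjoint hJI.symm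
    rw [union_comm]
    exact h2.of_delete
  · exact disjoint_union_left.2 ⟨disjoint_sdiff_left, hJI.symm⟩
  · rw [hI.contract_eq_contract_delete, delete_delete]
    have h3 : (M ／ I ＼ (C \ I ∪ D))✶ = (M ／ ((C \ I ∪ D) \ J ∪ I) ＼ J)✶ := by
      rw [dual_contract_delete, dual_contract_delete, ← contract_delete_comm _ hID,
        hJ.contract_eq_contract_delete, delete_delete, contract_delete_comm]
      exact disjoint_union_right.2 ⟨disjoint_sdiff_right, hJI⟩
    exact (dual_injective h3).symm

lemma contract_delete_sdiff_sdiff (hC : C' ⊆ C) (hD : D' ⊆ D) (hdj : Disjoint C D) :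
    M ／ C' ＼ D' ／ (C \ C') ＼ (D \ D') = M ／ C ＼ D := by
  rw [contract_delete_contract_delete _ _ _ _ _
    ((hdj.mono_left sdiff_subset).mono_right hD), union_sdiff_cancel hC, union_sdiff_cancel hD]

lemma IsMinor.of_subset_subset (hC : C' ⊆ C) (hD : D' ⊆ D) (hdj : Disjoint C D) :
    M ／ C ＼ D ≤m M ／ C' ＼ D' := by
  rw [← contract_delete_sdiff_sdiff hC hD hdj]
  exact contract_delete_isMinor ..

lemma mem_closure_contract_delete_iff (he : e ∉ C) (he' : e ∉ D) (hX : Disjoint X D) :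
    e ∈ (M ／ C ＼ D).closure X ↔ e ∈ M.closure (X ∪ C) := by
  rw [delete_closure_eq_of_disjoint _ hX, contract_closure_eq]
  simp [he, he']

/-- Subtracting the corank formulas for `X` and `X ∪ e` shows that `e` raises exactly one of the
corank of `X` and the rank of `E - (X ∪ e)`. -/
lemma mem_closure_dual_iff [M.Finite] (heE : e ∈ M.E) (heX : e ∉ X) (hX : X ⊆ M.E) :
    e ∈ M✶.closure X ↔ e ∉ M.closure (M.E \ insert e X) := by
  have h1 := rk_dual hX
  have h2 := rk_dual (insert_subset heE hX)
  have h3 : M.E \ X = insert e (M.E \ insert e X) := by grind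
  rw [ncard_insert_of_notMem heX (M.ground_finite.subset hX)] at h2
  push_cast at h2
  constructor
  · intro h h'
    have h4 := rk_insert_of_mem_closure h
    have h5 := rk_insert_of_mem_closure h'
    rw [← h3] at h5
    linarith
  · intro h
    refine mem_closure_of_rk_insert_le heE ?_
    have h5 := rk_insert_of_notMem_closure heE h
    rw [← h3] at h5
    linarith

lemma Coindep.rk_compl_eq [M.Finite] (h : M.Coindep D) : M.rk (M.E \ D) = M.rk M.E := by
  have h1 := rk_dual h.subset_ground
  have h2 := h.indep.rk_eq
  linarith

end Minor

end Matroid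

namespace Matroid

variable {α : Type*} {M N M' : Matroid α} {X Y C D A B S : Set α} {e f : α} {k : ℕ}
  {𝓜 : Set (Matroid α)}

/-! ### Duality of the hypotheses. -/

section Dual

lemma isSimple_dual_iff : M✶.IsSimple ↔ M.IsCosimple := Iff.rfl

lemma isCosimple_dual_iff : M✶.IsCosimple ↔ M.IsSimple := by
  simp [IsCosimple, IsSimple]

lemma isTriangle_dual_iff : M✶.IsTriangle X ↔ M.IsTriad X := Iff.rfl

lemma isTriad_dual_iff : M✶.IsTriad X ↔ M.IsTriangle X := by
  simp [IsTriad, IsTriangle]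

lemma IsUnionOfCocircuits.dual (h : M.IsUnionOfCocircuits X) : M✶.IsUnionOfCircuits X := h

lemma IsUnionOfCircuits.dual (h : M.IsUnionOfCircuits X) : M✶.IsUnionOfCocircuits X := by
  simpa [IsUnionOfCircuits, IsUnionOfCocircuits] using h

lemma IsExactSeparation.dual [M.Finite] (h : M.IsExactSeparation k A B) :
    M✶.IsExactSeparation k A B :=
  ⟨h.one_le, h.union_eq, h.disjoint, h.le_left, h.le_right,
    (connectivity_dual M A).trans h.connectivity_eq⟩

lemma isSimpleExtension_dual_iff : M✶.IsSimpleExtension N e ↔ M.IsCosimpleCoextension N✶ e := by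
  refine ⟨fun h ↦ ⟨h.mem_ground, ?_, fun h' ↦ h.not_isColoop (by simpa using h'), h.isSimple⟩,
    fun h ↦ ⟨h.mem_ground, ?_, fun h' ↦ h.not_isLoop (by simpa using h'), h.isCosimple⟩⟩
  · rw [← h.delete_eq, dual_delete, dual_dual]
  · rw [← dual_contract, h.contract_eq, dual_dual]

lemma isCosimpleCoextension_dual_iff :
    M✶.IsCosimpleCoextension N e ↔ M.IsSimpleExtension N✶ e := by
  rw [← dual_dual N, ← isSimpleExtension_dual_iff, dual_dual, dual_dual]

lemma IsTwoElementExpansion.of_dual (h : M✶.IsTwoElementExpansion N✶ e f) :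
    M.IsTwoElementExpansion N f e := by
  obtain ⟨M₁, h1, h2⟩ | ⟨M₂, h1, h2⟩ := h
  · rw [← dual_dual M₁, isSimpleExtension_dual_iff, dual_dual] at h1
    exact .inr ⟨_, h1, isCosimpleCoextension_dual_iff.1 h2⟩
  · rw [← dual_dual M₂, isCosimpleCoextension_dual_iff, dual_dual] at h1
    exact .inl ⟨_, h1, isSimpleExtension_dual_iff.1 h2⟩

end Dual

/-- The local conditions on `N`, its separation `(A, B)`, and its small expansions in a
minor-closed class `𝓜` under which `(A, B)` is induced in the members of `𝓜`. -/
structure IsInducer (𝓜 : Set (Matroid α)) (N : Matroid α) (k : ℕ) (A B : Set α) : Prop where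
  finite : ∀ M ∈ 𝓜, M.Finite
  minor : ∀ M ∈ 𝓜, ∀ N : Matroid α, N ≤m M → N ∈ 𝓜
  mem : N ∈ 𝓜
  isSimple : N.IsSimple
  isCosimple : N.IsCosimple
  isExactSeparation : N.IsExactSeparation k A B
  isUnionOfCircuits : N.IsUnionOfCircuits A
  isUnionOfCocircuits : N.IsUnionOfCocircuits A
  extension : ∀ M ∈ 𝓜, ∀ e : α, M.IsSimpleExtension N e →
    ∃ C, M.IsCircuit C ∧ e ∈ C ∧ (C ⊆ A ∪ {e} ∨ C ⊆ B ∪ {e})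
  coextension : ∀ M ∈ 𝓜, ∀ f : α, M.IsCosimpleCoextension N f →
    ∃ D, M.IsCocircuit D ∧ f ∈ D ∧ (D ⊆ A ∪ {f} ∨ D ⊆ B ∪ {f})
  expansion : ∀ M ∈ 𝓜, ∀ e f : α, M.IsTwoElementExpansion N e f →
    ∀ R : Set α, {e, f} ⊆ R → R ⊆ B ∪ {e, f} →
      (M.IsCircuit R →
        (∃ D, M.IsCocircuit D ∧ f ∈ D ∧ D ⊆ B ∪ {e, f}) ∨ ∃ g ∈ A, M.IsTriad {e, f, g}) ∧
      (M.IsCocircuit R →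
        (∃ C, M.IsCircuit C ∧ e ∈ C ∧ C ⊆ B ∪ {e, f}) ∨ ∃ g ∈ A, M.IsTriangle {e, f, g})

/-- Duality exchanges (i) with (ii), and (iii)(a) with (iii)(b) after swapping `e` and `f`; this
halves the later case analysis. -/
lemma IsInducer.dual (h : IsInducer 𝓜 N k A B) : IsInducer {M | M✶ ∈ 𝓜} N✶ k A B where
  finite M hM := by
    have := h.finite _ hM
    rw [← dual_dual M]
    infer_instance
  minor M hM N hN := h.minor _ hM _ hN.dual
  mem := by simpa using h.mem
  isSimple := isSimple_dual_iff.2 h.isCosimple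
  isCosimple := isCosimple_dual_iff.2 h.isSimple
  isExactSeparation :=
    have := h.finite _ h.mem
    h.isExactSeparation.dual
  isUnionOfCircuits := h.isUnionOfCocircuits.dual
  isUnionOfCocircuits := h.isUnionOfCircuits.dual
  extension M hM e hMe := by
    rw [← isCosimpleCoextension_dual_iff] at hMe
    simpa using h.coextension _ hM e hMe
  coextension M hM f hMf := by
    rw [← isSimpleExtension_dual_iff] at hMf
    exact h.extension _ hM f hMf
  expansion M hM e f hMef R hR hRB := by
    rw [← dual_dual M] at hMef
    rw [pair_comm e f] at hR hRB
    have h' := h.expansion _ hM f e hMef.of_dual R hR hRB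
    refine ⟨fun hc ↦ ?_, fun hc ↦ ?_⟩
    · obtain ⟨C, hC⟩ | ⟨g, hg, hT⟩ := h'.2 (by simpa using hc)
      · exact .inl ⟨C, by simpa [pair_comm] using hC⟩
      · rw [insert_comm, isTriangle_dual_iff] at hT
        exact .inr ⟨g, hg, hT⟩
    · obtain ⟨C, hC⟩ | ⟨g, hg, hT⟩ := h'.1 hc
      · exact .inl ⟨C, by simpa [pair_comm] using hC⟩
      · rw [insert_comm, isTriad_dual_iff] at hT
        exact .inr ⟨g, hg, hT⟩

/-- `A` and `B` are separated in `M` by a set of connectivity less than `k`. -/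
def Separates (M : Matroid α) (k : ℕ) (A B : Set α) : Prop :=
  ∃ X, A ⊆ X ∧ Disjoint X B ∧ M.connectivity X ≤ (k : ℤ) - 1

lemma separates_dual_iff [M.Finite] : M✶.Separates k A B ↔ M.Separates k A B := by
  simp [Separates, connectivity_dual]

/-! ### Relabelling by permutations; swapping parallel or series elements. -/

section Map

lemma mapEquiv_dual (M : Matroid α) (σ : Equiv.Perm α) : (M.mapEquiv σ)✶ = M✶.mapEquiv σ := by
  rw [mapEquiv_eq_map, mapEquiv_eq_map, map_dual]

lemma mapEquiv_delete (M : Matroid α) (σ : Equiv.Perm α) (D : Set α) :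
    (M ＼ D).mapEquiv σ = (M.mapEquiv σ) ＼ (σ '' D) := by
  refine ext_indep (by simp [image_sdiff σ.injective]) fun I _ ↦ ?_
  simp only [mapEquiv_indep_iff, delete_indep_iff]
  rw [← disjoint_image_iff σ.injective, σ.image_symm_image]

lemma mapEquiv_contract (M : Matroid α) (σ : Equiv.Perm α) (C : Set α) :
    (M ／ C).mapEquiv σ = (M.mapEquiv σ) ／ (σ '' C) := by
  rw [← dual_inj, mapEquiv_dual, dual_contract, dual_contract, mapEquiv_delete, mapEquiv_dual]

lemma IsMinor.mapEquiv (h : N ≤m M) (σ : Equiv.Perm α) : N.mapEquiv σ ≤m M.mapEquiv σ := by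
  obtain ⟨C, D, rfl⟩ := h
  rw [mapEquiv_delete, mapEquiv_contract]
  exact contract_delete_isMinor ..

lemma connectivity_mapEquiv (M : Matroid α) (σ : Equiv.Perm α) (X : Set α) :
    (M.mapEquiv σ).connectivity (σ '' X) = M.connectivity X := by
  have h : ∀ Y, (M.mapEquiv σ).eRk (σ '' Y) = M.eRk Y := by
    intro Y
    rw [← eRk_inter_ground, mapEquiv_ground_eq, ← image_inter σ.injective, mapEquiv_eq_map,
      eRk_map _ _ inter_subset_right, eRk_inter_ground]
  simp only [connectivity_eq_rk, rk, mapEquiv_ground_eq]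
  rw [← image_sdiff σ.injective, h, h, h]

lemma mapEquiv_mapEquiv_symm (M : Matroid α) (σ : Equiv.Perm α) :
    (M.mapEquiv σ).mapEquiv σ.symm = M := by
  refine ext_indep ?_ fun I _ ↦ ?_
  · rw [mapEquiv_ground_eq, mapEquiv_ground_eq, Equiv.symm_image_image]
  · rw [mapEquiv_indep_iff, mapEquiv_indep_iff, Equiv.symm_symm, Equiv.symm_image_image]

lemma map_eq_mapEquiv {φ : α → α} (hφ : InjOn φ M.E) (σ : Equiv.Perm α)
    (h : ∀ x ∈ M.E, σ x = φ x) : M.map φ hφ = M.mapEquiv σ := by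
  have himg : ∀ I ⊆ M.E, φ '' I = σ '' I := fun I hI ↦
    image_congr fun x hx ↦ (h x (hI hx)).symm
  refine ext_indep (by simp [himg _ subset_rfl]) fun I _ ↦ ?_
  rw [map_indep_iff, mapEquiv_eq_map, map_indep_iff]
  refine exists_congr fun J ↦ and_congr_right fun hJ ↦ ?_
  rw [himg _ hJ.subset_ground]

lemma _root_.Set.InjOn.exists_perm_eqOn {s : Set α} (hs : s.Finite) {φ : α → α}
    (hφ : InjOn φ s) : ∃ σ : Equiv.Perm α, ∀ x ∈ s, σ x = φ x := by
  classical
  have : Finite {x | x ∈ s} := hs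
  exact ⟨(Equiv.Set.imageOfInjOn φ s hφ : {x // x ∈ s} ≃ {x // x ∈ φ '' s}).extendSubtype,
    fun x hx ↦ Equiv.extendSubtype_apply_of_mem _ x hx⟩

lemma image_swap_eq_self [DecidableEq α] (he : e ∉ X) (hf : f ∉ X) : Equiv.swap e f '' X = X := by
  have h : EqOn (Equiv.swap e f) id X := fun x hx ↦ Equiv.swap_apply_of_ne_of_ne
    (by rintro rfl; exact he hx) (by rintro rfl; exact hf hx)
  rw [h.image_eq, image_id]

/-- Parallel elements span each other, so either may replace the other in any independent set. -/
lemma delete_mapEquiv_swap_eq_of_isCircuit [DecidableEq α] (h : M.IsCircuit {e, f})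
    (hef : e ≠ f) : (M ＼ {e}).mapEquiv (Equiv.swap e f) = M ＼ {f} := by
  have he : e ∈ M.E := h.subset_ground (by simp)
  have hf : f ∈ M.E := h.subset_ground (by simp)
  have hcl : ∀ I, M.closure (insert e I) = M.closure (insert f I) := by
    have key : ∀ e f, M.IsCircuit {e, f} → e ≠ f → ∀ I, M.closure (insert e I) ⊆
        M.closure (insert f I) := by
      intro e f h hef I
      have h1 := h.mem_closure_sdiff_singleton_of_mem (e := e) (by simp)
      rw [show ({e, f} : Set α) \ {e} = {f} by grind] at h1
      have h2 : e ∈ M.closure (insert f I) := M.closure_subset_closure (by simp) h1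
      rw [← closure_insert_eq_of_mem_closure h2]
      exact M.closure_subset_closure (insert_subset_insert (subset_insert _ _))
    exact fun I ↦ (key e f h hef I).antisymm (key f e (by rwa [pair_comm]) hef.symm I)
  have hind : ∀ I, e ∉ I → f ∉ I → (M.Indep (insert e I) ↔ M.Indep (insert f I)) := by
    have key : ∀ e f, (∀ I, M.closure (insert e I) = M.closure (insert f I)) → f ∈ M.E →
        ∀ I, e ∉ I → f ∉ I → M.Indep (insert e I) → M.Indep (insert f I) := by
      intro e f hcl hf I heI hfI hi
      have hI : M.Indep I := hi.subset (subset_insert _ _)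
      rw [hI.insert_indep_iff_of_notMem hfI]
      rw [hI.insert_indep_iff_of_notMem heI] at hi
      refine ⟨hf, fun hf' ↦ hi.2 ?_⟩
      rw [← closure_insert_eq_of_mem_closure hf', ← hcl]
      exact M.mem_closure_of_mem' (mem_insert _ _) hi.1
    exact fun I h1 h2 ↦ ⟨key e f hcl hf I h1 h2, key f e (fun I ↦ (hcl I).symm) he I h2 h1⟩
  refine ext_indep ?_ fun I hI ↦ ?_
  · ext x
    simp only [mapEquiv_ground_eq, delete_ground, Equiv.image_eq_preimage_symm, Equiv.symm_swap,
      mem_preimage, mem_sdiff, mem_singleton_iff]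
    rcases eq_or_ne x e with rfl | hxe
    · simp [hf, hef, hef.symm, he]
    rcases eq_or_ne x f with rfl | hxf
    · simp
    simp [Equiv.swap_apply_of_ne_of_ne hxe hxf, hxe, hxf]
  · have hfI : f ∉ I := by
      intro hfI
      obtain ⟨x, hx, hxf⟩ := hI hfI
      rw [Equiv.coe_toEmbedding, ← Equiv.eq_symm_apply, Equiv.symm_swap,
        Equiv.swap_apply_right] at hxf
      exact hx.2 hxf
    rw [mapEquiv_indep_iff, Equiv.symm_swap, deleteElem_indep_iff, deleteElem_indep_iff]
    by_cases heI : e ∈ I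
    · obtain ⟨J, rfl, heJ⟩ : ∃ J, I = insert e J ∧ e ∉ J := ⟨I \ {e}, by simp [heI], by simp⟩
      have hfJ : f ∉ J := fun h ↦ hfI (by simp [h])
      have himg := image_swap_eq_self heJ hfJ
      rw [image_insert_eq, himg, Equiv.swap_apply_left, hind J heJ hfJ]
      simp [hef, hef.symm, heJ, hfJ]
    · have himg := image_swap_eq_self heI hfI
      simp [himg, heI, hfI]

lemma contract_mapEquiv_swap_eq_of_isCocircuit [DecidableEq α] (h : M.IsCocircuit {e, f})
    (hef : e ≠ f) : (M ／ {e}).mapEquiv (Equiv.swap e f) = M ／ {f} := by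
  rw [← dual_inj, mapEquiv_dual, dual_contract, dual_contract]
  exact delete_mapEquiv_swap_eq_of_isCircuit h hef

end Map

end Matroid

/-! ### What conditions (ii) and (iii) force in small minors. -/

namespace Matroid

variable {α : Type*} {M N P : Matroid α} {X Y C D A B S K : Set α} {e f g : α} {k : ℕ}
  {𝓜 : Set (Matroid α)}

lemma IsCocircuit.notMem_closure_of_disjoint (hK : M.IsCocircuit K) (he : e ∈ K)
    (hKX : Disjoint K X) : e ∉ M.closure X := by
  intro hcl
  obtain ⟨C, hCX, hC, heC⟩ := exists_isCircuit_of_mem_closure hcl (hKX.notMem_of_mem_left he)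
  refine hC.inter_isCocircuit_ne_singleton hK (e := e) ?_
  refine subset_antisymm (fun x hx ↦ ?_) (by simp [he, heC])
  exact (hCX hx.1).resolve_right (hKX.notMem_of_mem_left hx.2)

lemma exists_eq_pair_of_encard_lt_three (he : e ∈ X) (hX : X.encard < 3) :
    ∃ y, X = {e, y} := by
  have h1 := encard_sdiff_singleton_add_one he
  have h2 : (X \ {e}).encard ≤ 1 := by
    rw [← ENat.lt_add_one_iff (by simp)]
    have h3 : (X \ {e}).encard + 1 < 1 + 1 + 1 := by
      rw [h1]; exact hX.trans_eq (by norm_num)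
    exact lt_of_add_lt_add_right h3
  have h4 : insert e (X \ {e}) = X := by simp [he]
  obtain h | ⟨y, hy⟩ := encard_le_one_iff_eq.1 h2
  · exact ⟨e, by rw [← h4, h]; simp⟩
  · exact ⟨y, by rw [← h4, hy]⟩

namespace IsInducer

lemma disjoint (h : IsInducer 𝓜 N k A B) : Disjoint A B := h.isExactSeparation.disjoint

lemma union_eq (h : IsInducer 𝓜 N k A B) : A ∪ B = N.E := h.isExactSeparation.union_eq

lemma notMem_closure (h : IsInducer 𝓜 N k A B) (hg : g ∈ A) : g ∉ N.closure B := by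
  obtain ⟨𝒟, h𝒟, rfl⟩ := h.isUnionOfCocircuits
  obtain ⟨D, hD, hgD⟩ := hg
  exact (h𝒟 D hD).notMem_closure_of_disjoint hgD
    (h.disjoint.mono_left (subset_sUnion_of_mem hD))

/-- This is (ii) freed from cosimplicity. As `N` is cosimple, a cocircuit of `P` with at most two
elements contains `f`, so it already lies in `A ∪ f` or `B ∪ f`. The cocircuit obtained cannot avoid
`A`, which spans `f`, so it avoids `B`. -/
lemma notMem_closure_right (h : IsInducer 𝓜 N k A B) (hP : P ∈ 𝓜) (hfP : f ∈ P.E)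
    (hN : P ／ {f} = N) (hf : ¬ P.IsLoop f) (hfA : f ∈ P.closure A) : f ∉ P.closure B := by
  obtain ⟨D, hD, hfD, hD'⟩ : ∃ D, P.IsCocircuit D ∧ f ∈ D ∧ (D ⊆ A ∪ {f} ∨ D ⊆ B ∪ {f}) := by
    by_cases hcs : P.IsCosimple
    · exact h.coextension P hP f ⟨hfP, hN, hf, hcs⟩
    simp only [IsCosimple, not_forall, not_le] at hcs
    obtain ⟨K, hK, hK3⟩ := hcs
    by_cases hfK : f ∈ K
    · obtain ⟨y, rfl⟩ := exists_eq_pair_of_encard_lt_three hfK hK3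
      refine ⟨_, hK, hfK, ?_⟩
      have hy : y ∈ P.E := hK.subset_ground (by simp)
      have hE : ∀ x, (x ∈ A ∨ x ∈ B) ↔ x ∈ P.E ∧ x ≠ f := by
        simp [← mem_union, h.union_eq, ← hN]
      grind
    have hK' : N.IsCocircuit K := by
      rw [← hN, contract_isCocircuit_iff]
      exact ⟨hK, by simpa using hfK⟩
    exact (hK3.not_ge (h.isCosimple K hK')).elim
  have hE : ∀ x, (x ∈ A ∨ x ∈ B) ↔ x ∈ P.E ∧ x ≠ f := by
    simp [← mem_union, h.union_eq, ← hN]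
  have hdj := h.disjoint
  obtain hD' | hD' := hD'
  · exact hD.notMem_closure_of_disjoint hfD (by grind)
  · exact (hD.notMem_closure_of_disjoint hfD (by grind) hfA).elim

/-- The span conditions produce a circuit `R` through `e` and `f` in `B ∪ {e, f}`, the input of
(iii)(a). Its first outcome fails because a cocircuit through `f` must meet `A`, which spans `f`. If
no triad exists, the span conditions also exclude the small circuits and cocircuits that would
violate simplicity or cosimplicity. -/
lemma exists_isTriad (h : IsInducer 𝓜 N k A B) (hP : P ∈ 𝓜) (hef : e ≠ f) (heP : e ∈ P.E)
    (hfP : f ∈ P.E) (hN : P ／ {f} ＼ {e} = N) (hfl : ¬ P.IsLoop f) (hec : ¬ P.IsColoop e)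
    (heB : e ∈ P.closure (insert f B)) (heB' : e ∉ P.closure B) (hfA : f ∈ P.closure A)
    (hef' : e ∉ P.closure {f}) : ∃ g ∈ A, P.IsTriad {e, f, g} := by
  by_contra! hcon
  have hE : ∀ x, (x ∈ A ∨ x ∈ B) ↔ (x ∈ P.E ∧ x ≠ f) ∧ x ≠ e := by
    simp [← mem_union, h.union_eq, ← hN]
  have hdj := h.disjoint
  have heA : e ∉ A := by grind
  have heBm : e ∉ B := by grind
  have hfAm : f ∉ A := by grind
  have hfBm : f ∉ B := by grind
  have hN' : (P ＼ {e}) ／ {f} = N := by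
    rw [← contract_delete_comm _ (by simpa using hef.symm), hN]
  have hfB : f ∈ P.closure (insert e B) := mem_closure_insert heB' heB
  have hgB : ∀ g ∈ A, g ∉ P.closure (insert f B) := by
    intro g hg hgB
    refine h.notMem_closure hg ?_
    rw [← hN, mem_closure_contract_delete_iff (by grind) (by grind) (by simpa using heBm)]
    simpa using hgB
  obtain ⟨R, hRB, hR, heR⟩ := exists_isCircuit_of_mem_closure heB (by simp [hef, heBm])
  have hfR : f ∈ R := by
    by_contra hfR
    exact heB' (P.closure_subset_closure (by grind) (hR.mem_closure_sdiff_singleton_of_mem heR))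
  have hcoext : (P ＼ {e}).IsCosimpleCoextension N f := by
    refine ⟨⟨hfP, hef.symm⟩, hN', by simp [hfl], fun K hK ↦ ?_⟩
    by_contra! hK3
    by_cases hfK : f ∈ K
    · obtain ⟨y, rfl⟩ := exists_eq_pair_of_encard_lt_three hfK hK3
      have hyE : y ∈ (P ＼ {e}).E := hK.subset_ground (by simp)
      -- A series pair `{f, y}` with `y ∈ A` either extends by `e` to a forbidden triad or is a
      -- cocircuit of `P` avoiding `B ∪ e`, which spans `f`. If `y ∉ A`, it avoids `A`, which also
      -- spans `f`.
      by_cases hyA : y ∈ A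
      · rw [isCocircuit_def, dual_delete] at hK
        obtain ⟨K', hK', hKK', hK'e⟩ := hK.exists_subset_isCircuit_of_contract
        by_cases heK' : e ∈ K'
        · have hKeq : K' = {e, f, y} := by grind
          refine hcon y hyA ⟨hKeq ▸ hK', ?_⟩
          rw [encard_insert_of_notMem (by grind), encard_pair (by grind)]
          norm_num
        · exact IsCocircuit.notMem_closure_of_disjoint hK' (hKK' (by simp))
            (X := insert e B) (by grind) hfB
      · refine hK.notMem_closure_of_disjoint hfK (X := A) (by grind) ?_
        rw [delete_closure_eq_of_disjoint _ (by simpa using heA)]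
        exact ⟨hfA, hef.symm⟩
    · have hK' : N.IsCocircuit K := by
        rw [← hN', contract_isCocircuit_iff]
        exact ⟨hK, by simpa using hfK⟩
      exact hK3.not_ge (h.isCosimple K hK')
  have hext : P.IsSimpleExtension (P ＼ {e}) e := by
    refine ⟨heP, rfl, hec, fun K hK ↦ ?_⟩
    by_contra! hK3
    by_cases heK : e ∈ K
    · obtain ⟨y, rfl⟩ := exists_eq_pair_of_encard_lt_three heK hK3
      have hyE : y ∈ P.E := hK.subset_ground (by simp)
      have hey : e ∈ P.closure ({e, y} \ {e}) := hK.mem_closure_sdiff_singleton_of_mem heK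
      by_cases hyf : y = f
      · exact hef' (P.closure_subset_closure (by grind) hey)
      by_cases hyB : y = e ∨ y ∈ B
      · exact heB' (P.closure_subset_closure (by grind) hey)
      -- Here `y ∈ A` is parallel to `e`, hence spanned by `B ∪ f`; that would put `y` in the
      -- closure of `B` in `N`.
      refine hgB y (by grind) ?_
      rw [← closure_insert_eq_of_mem_closure heB]
      exact P.closure_subset_closure (by grind)
        (hK.mem_closure_sdiff_singleton_of_mem (e := y) (by simp))
    · have hK' : (P ＼ {e}).IsCircuit K := by
        rw [delete_isCircuit_iff]
        exact ⟨hK, by simpa using heK⟩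
      have hKf : ¬ K ⊆ {f} := by
        intro hKf
        obtain rfl : K = {f} := (subset_singleton_iff_eq.1 hKf).resolve_left hK.nonempty.ne_empty
        exact hfl (singleton_isCircuit.1 hK)
      have hdep := hK'.contract_dep_of_not_subset hKf
      rw [hN'] at hdep
      obtain ⟨C, hCK, hC⟩ := hdep.exists_isCircuit_subset
      exact hK3.not_ge ((h.isSimple C hC).trans (encard_le_encard (hCK.trans sdiff_subset)))
  obtain ⟨D, hD, hfD, hDB⟩ | ⟨g, hg, hT⟩ :=
    (h.expansion P hP e f (.inr ⟨_, hcoext, hext⟩) R (by grind) (by grind)).1 hR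
  · exact hD.notMem_closure_of_disjoint hfD (by grind) hfA
  · exact hcon g hg hT

end IsInducer

end Matroid

namespace Matroid

variable {α : Type*} {M N P K : Matroid α} {X X₁ X₂ Y C D A B S F : Set α} {e f g : α} {k : ℕ}
  {𝓜 : Set (Matroid α)}

lemma Coindep.of_subset (h : M.Coindep D) (hS : S ⊆ D) : M.Coindep S :=
  h.indep.subset hS

lemma delete_isMinor (M : Matroid α) (D : Set α) : M ＼ D ≤m M := by
  simpa using contract_delete_isMinor M ∅ D

lemma contract_isMinor (M : Matroid α) (C : Set α) : M ／ C ≤m M := by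
  simpa using contract_delete_isMinor M C ∅

/-! ### Uncrossing separations of deletions and contractions. -/

section Uncrossing

variable [M.Finite]

lemma connectivity_delete (M : Matroid α) (e : α) (X : Set α) :
    (M ＼ {e}).connectivity X =
      M.rk (X \ {e}) + M.rk ((M.E \ {e}) \ X) - M.rk (M.E \ {e}) := by
  rw [connectivity_eq_rk, rk_delete, rk_delete, rk_delete, delete_ground,
    show ((M.E \ {e}) \ X) \ {e} = (M.E \ {e}) \ X by grind,
    show (M.E \ {e}) \ {e} = M.E \ {e} by grind]

lemma connectivity_contract (he : e ∈ M.E) (X : Set α) :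
    (M ／ {e}).connectivity X =
      M.rk (insert e X) + M.rk (insert e (M.E \ X)) - M.rk {e} - M.rk M.E := by
  rw [connectivity_eq_rk, rk_contract (by simpa using he), rk_contract (by simpa using he),
    rk_contract (by simpa using he), contract_ground, union_singleton,
    show (M.E \ {e}) \ X ∪ {e} = insert e (M.E \ X) by grind,
    show M.E \ {e} ∪ {e} = M.E by grind]
  ring

/-- Connectivity is uncrossed by the deletion and the contraction of a single element. -/
lemma connectivity_inter_add_connectivity_insert_union_le (he : e ∈ M.E) (X₁ X₂ : Set α) :
    M.connectivity ((X₁ ∩ X₂) \ {e}) + M.connectivity (insert e (X₁ ∪ X₂)) ≤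
      (M ＼ {e}).connectivity X₁ + (M ／ {e}).connectivity X₂ + 1 := by
  rw [connectivity_delete, connectivity_contract he, connectivity_eq_rk, connectivity_eq_rk]
  have h1 := M.rk_inter_add_rk_union_le (X₁ \ {e}) (insert e X₂)
  have h2 := M.rk_inter_add_rk_union_le ((M.E \ {e}) \ X₁) (insert e (M.E \ X₂))
  rw [show X₁ \ {e} ∩ insert e X₂ = (X₁ ∩ X₂) \ {e} by grind,
    show X₁ \ {e} ∪ insert e X₂ = insert e (X₁ ∪ X₂) by grind] at h1
  rw [show (M.E \ {e}) \ X₁ ∩ insert e (M.E \ X₂) = M.E \ insert e (X₁ ∪ X₂) by grind,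
    show (M.E \ {e}) \ X₁ ∪ insert e (M.E \ X₂) = M.E \ ((X₁ ∩ X₂) \ {e}) by grind] at h2
  have h3 := M.rk_singleton_le e
  have h4 := M.rk_mono (sdiff_subset : M.E \ {e} ⊆ M.E)
  linarith

/-- Submodularity is applied on each side. Coindependence makes all the ground-set ranks equal, and
having `f ∈ X₁` and `e ∈ X₂` makes the union lose no element, so there is no error term. -/
lemma connectivity_union_add_connectivity_delete_delete_le (hef : e ≠ f)
    (hco : M.Coindep {e, f}) (hf : f ∈ X₁) (he : e ∈ X₂) :
    M.connectivity (X₁ ∪ X₂) + (M ＼ {e} ＼ {f}).connectivity (X₁ ∩ X₂) ≤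
      (M ＼ {e}).connectivity X₁ + (M ＼ {f}).connectivity X₂ := by
  rw [connectivity_delete, connectivity_delete, connectivity_delete, connectivity_eq_rk,
    rk_delete, rk_delete, rk_delete, delete_ground]
  have h1 := M.rk_inter_add_rk_union_le (X₁ \ {e}) (X₂ \ {f})
  have h2 := M.rk_inter_add_rk_union_le ((M.E \ {e}) \ X₁) ((M.E \ {f}) \ X₂)
  rw [show X₁ \ {e} ∩ (X₂ \ {f}) = ((X₁ ∩ X₂) \ {f}) \ {e} by grind,
    show X₁ \ {e} ∪ X₂ \ {f} = X₁ ∪ X₂ by grind] at h1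
  rw [show (M.E \ {e}) \ X₁ ∩ ((M.E \ {f}) \ X₂) = M.E \ (X₁ ∪ X₂) by grind,
    show (M.E \ {e}) \ X₁ ∪ (M.E \ {f}) \ X₂ = (((M.E \ {e}) \ {f}) \ (X₁ ∩ X₂)) \ {e} by grind]
    at h2
  have h3 := (hco.of_subset (S := {e}) (by simp)).rk_compl_eq
  have h4 := (hco.of_subset (S := {f}) (by simp)).rk_compl_eq
  have h5 := hco.rk_compl_eq
  rw [show ((M.E \ {e}) \ {f}) \ {e} = M.E \ {e, f} by grind]
  linarith

lemma connectivity_union_add_connectivity_delete_contract_le (hef : e ≠ f)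
    (hco : M.Coindep {e}) (hi : M.Indep {f}) (hf : f ∈ X₁) (he : e ∈ X₂) :
    M.connectivity (X₁ ∪ X₂) + (M ／ {f} ＼ {e}).connectivity (X₁ ∩ X₂) ≤
      (M ＼ {e}).connectivity X₁ + (M ／ {f}).connectivity X₂ := by
  have hfE : f ∈ M.E := hi.subset_ground rfl
  have hfE' : f ∈ (M ＼ {e}).E := ⟨hfE, hef.symm⟩
  rw [contract_delete_comm _ (by simpa using hef.symm), connectivity_delete,
    connectivity_contract hfE, connectivity_contract hfE', connectivity_eq_rk,
    rk_delete, rk_delete, rk_delete, rk_delete, delete_ground]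
  have h1 := M.rk_inter_add_rk_union_le (X₁ \ {e}) (insert f X₂)
  have h2 := M.rk_inter_add_rk_union_le ((M.E \ {e}) \ X₁) (insert f (M.E \ X₂))
  rw [show X₁ \ {e} ∩ insert f X₂ = insert f (X₁ ∩ X₂) \ {e} by grind,
    show X₁ \ {e} ∪ insert f X₂ = X₁ ∪ X₂ by grind] at h1
  rw [show (M.E \ {e}) \ X₁ ∩ insert f (M.E \ X₂) = M.E \ (X₁ ∪ X₂) by grind,
    show (M.E \ {e}) \ X₁ ∪ insert f (M.E \ X₂) =
      insert f ((M.E \ {e}) \ (X₁ ∩ X₂)) \ {e} by grind] at h2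
  have h3 := hco.rk_compl_eq
  rw [show (M.E \ {e}) \ {e} = M.E \ {e} by grind,
    show ({f} : Set α) \ {e} = {f} by grind]
  linarith

end Uncrossing

/-- A matroid `M` in the class that has `N = M ／ C ＼ D` as a minor without inducing the
separation `(A, B)`, while `(A, B)` is induced in every smaller matroid of the class for every
copy of `N`. -/
structure IsMinimalFailure (𝓜 : Set (Matroid α)) (N : Matroid α) (k : ℕ) (A B : Set α)
    (M : Matroid α) (C D : Set α) : Prop where
  isInducer : IsInducer 𝓜 N k A B
  mem : M ∈ 𝓜
  contract_delete_eq : M ／ C ＼ D = N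
  indep : M.Indep C
  coindep : M.Coindep D
  disjoint : Disjoint C D
  separates_of_lt : ∀ M₁ ∈ 𝓜, M₁.E.ncard < M.E.ncard → ∀ σ : Equiv.Perm α,
    N.mapEquiv σ ≤m M₁ → M₁.Separates k (σ '' A) (σ '' B)
  not_separates : ¬ M.Separates k A B

/-! ### Elements of `C` and `D` in a minimal failure. -/

namespace IsMinimalFailure

lemma finite (h : IsMinimalFailure 𝓜 N k A B M C D) : M.Finite := h.isInducer.finite M h.mem

lemma dual (h : IsMinimalFailure 𝓜 N k A B M C D) :
    IsMinimalFailure {M | M✶ ∈ 𝓜} N✶ k A B M✶ D C where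
  isInducer := h.isInducer.dual
  mem := by simpa using h.mem
  contract_delete_eq := by
    rw [← h.contract_delete_eq, dual_contract_delete, contract_delete_comm _ h.disjoint.symm]
  indep := h.coindep
  coindep := by simpa using h.indep
  disjoint := h.disjoint.symm
  separates_of_lt M₁ hM₁ hlt σ hσ := by
    have := h.isInducer.finite _ hM₁
    have h1 := h.separates_of_lt _ hM₁ hlt σ (by simpa [mapEquiv_dual] using hσ.dual)
    rwa [← separates_dual_iff, dual_dual] at h1
  not_separates := by
    have := h.finite
    rw [separates_dual_iff]
    exact h.not_separates

lemma separates_of_isMinor (h : IsMinimalFailure 𝓜 N k A B M C D) (hK : K ≤m M)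
    (he : e ∈ M.E) (heK : e ∉ K.E) (hN : N ≤m K) : K.Separates k A B := by
  have := h.finite
  have h1 := h.separates_of_lt K (h.isInducer.minor _ h.mem _ hK)
    (ncard_lt_ncard (hK.subset.ssubset_of_ne (by rintro h; exact heK (h ▸ he))) M.ground_finite)
    (Equiv.refl α) (by convert hN using 1; exact map_id)
  simpa using h1

lemma mem_ground_iff (h : IsMinimalFailure 𝓜 N k A B M C D) (x : α) :
    x ∈ A ∨ x ∈ B ↔ (x ∈ M.E ∧ x ∉ C) ∧ x ∉ D := by
  simp [← mem_union, h.isInducer.union_eq, ← h.contract_delete_eq]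

lemma rk_ground_diff (h : IsMinimalFailure 𝓜 N k A B M C D) (hS : S ⊆ D) :
    M.rk (M.E \ S) = M.rk M.E :=
  have := h.finite
  (h.coindep.of_subset hS).rk_compl_eq

lemma connectivity_eq (h : IsMinimalFailure 𝓜 N k A B M C D) (hA : A ⊆ X) (hB : Disjoint X B) :
    N.connectivity X = (k : ℤ) - 1 := by
  rw [← h.isInducer.isExactSeparation.connectivity_eq]
  refine connectivity_congr ?_
  rw [← h.isInducer.union_eq]
  grind

/-- This is `λ_N(A) = k - 1` expressed through ranks in `M`. -/
lemma rk_eq (h : IsMinimalFailure 𝓜 N k A B M C D) :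
    M.rk (A ∪ C) + M.rk (B ∪ C) - C.ncard - M.rk M.E = (k : ℤ) - 1 := by
  have := h.finite
  have hdj := h.isInducer.disjoint
  have hE := h.mem_ground_iff
  rw [← h.connectivity_eq subset_rfl hdj, ← h.indep.rk_eq, connectivity_eq_rk,
    ← h.contract_delete_eq, rk_delete, rk_delete, rk_delete, rk_contract h.indep.subset_ground,
    rk_contract h.indep.subset_ground, rk_contract h.indep.subset_ground, delete_ground,
    contract_ground, ← h.rk_ground_diff subset_rfl]
  have hC := h.indep.subset_ground
  have hCD := h.disjoint
  rw [show A \ D ∪ C = A ∪ C by grind,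
    show (((M.E \ C) \ D) \ A) \ D ∪ C = B ∪ C by grind,
    show ((M.E \ C) \ D) \ D ∪ C = M.E \ D by grind]
  ring

/-- If `e ∈ D` is not spanned by `B ∪ C`, then `e` is on the side of `A` in each separation that
induces `(A, B)`. -/
lemma mem_of_notMem_closure (h : IsMinimalFailure 𝓜 N k A B M C D) (he : e ∈ D)
    (hecl : e ∉ M.closure (B ∪ C)) (hK : M ／ C ＼ (D \ {e}) ≤m K) (hKf : K.Finite) (hA : A ⊆ X)
    (hB : Disjoint X B) (hX : K.connectivity X ≤ (k : ℤ) - 1) : e ∈ X := by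
  by_contra heX
  have := h.finite
  have hdj := h.isInducer.disjoint
  have hE := h.mem_ground_iff
  have hC := h.indep.subset_ground
  have hD : D ⊆ M.E := h.coindep.subset_ground
  have hCD := h.disjoint
  have h1 := (hK.connectivity_le X).trans hX
  have h2 := rk_insert_of_notMem_closure (hD he) hecl
  rw [connectivity_eq_rk, rk_delete, rk_delete, rk_delete, rk_contract hC, rk_contract hC,
    rk_contract hC, delete_ground, contract_ground,
    show (((M.E \ C) \ (D \ {e})) \ X) \ (D \ {e}) ∪ C = insert e (B ∪ C) by grind,
    show ((M.E \ C) \ (D \ {e})) \ (D \ {e}) ∪ C = M.E \ (D \ {e}) by grind,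
    h.rk_ground_diff sdiff_subset, h2, h.indep.rk_eq] at h1
  -- With `e` on the side of `B`, that side has rank one more than in `N` and the other side has not
  -- dropped, so the connectivity would be at least `k`.
  have h3 := M.rk_mono (show A ∪ C ⊆ X \ (D \ {e}) ∪ C by grind)
  have h4 := h.rk_eq
  linarith

/-- The dual form of `Matroid.IsMinimalFailure.mem_of_notMem_closure`. -/
lemma mem_of_notMem_dual_closure (h : IsMinimalFailure 𝓜 N k A B M C D) (hf : f ∈ C)
    (hfcl : f ∉ M✶.closure (B ∪ D)) (hK : M ／ (C \ {f}) ＼ D ≤m K) (hKf : K.Finite)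
    (hA : A ⊆ X) (hB : Disjoint X B) (hX : K.connectivity X ≤ (k : ℤ) - 1) : f ∈ X := by
  refine h.dual.mem_of_notMem_closure (K := K✶) hf hfcl ?_ inferInstance hA hB
    ((connectivity_dual K X).trans_le hX)
  rw [contract_delete_comm _ (h.disjoint.symm.mono_right sdiff_subset), ← dual_contract_delete]
  exact hK.dual

/-- For distinct `e` and `f`, the separations of `M ＼ e` and `M ＼ f` have `f` and `e` on the side of
`A`. Their intersection has connectivity at least `k - 1` since `N` survives in `M ＼ e ＼ f`, so
their union would separate `M`. -/
lemma eq_of_notMem_closure (h : IsMinimalFailure 𝓜 N k A B M C D) (he : e ∈ D) (hf : f ∈ D)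
    (hecl : e ∉ M.closure (B ∪ C)) (hfcl : f ∉ M.closure (B ∪ C)) : e = f := by
  by_contra hef
  have := h.finite
  have hD : D ⊆ M.E := h.coindep.subset_ground
  have hmin : ∀ x ∈ D, ∀ y ∈ D, x ≠ y → M ／ C ＼ (D \ {y}) ≤m M ＼ {x} := by
    intro x hx y hy hxy
    have := IsMinor.of_subset_subset (M := M) (empty_subset C) (show {x} ⊆ D \ {y} by grind)
      (h.disjoint.mono_right sdiff_subset)
    rwa [contract_empty] at this
  have hsep : ∀ x ∈ D, (M ＼ {x}).Separates k A B := by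
    intro x hx
    refine h.separates_of_isMinor (delete_isMinor M {x}) (hD hx) (by simp) ?_
    have := IsMinor.of_subset_subset (M := M) (empty_subset C) (show {x} ⊆ D by simpa) h.disjoint
    rwa [contract_empty, h.contract_delete_eq] at this
  obtain ⟨X₁, hA₁, hB₁, hX₁⟩ := hsep e he
  obtain ⟨X₂, hA₂, hB₂, hX₂⟩ := hsep f hf
  have hf₁ := h.mem_of_notMem_closure hf hfcl (hmin e he f hf hef) inferInstance hA₁ hB₁ hX₁
  have he₂ := h.mem_of_notMem_closure he hecl (hmin f hf e he (Ne.symm hef)) inferInstance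
    hA₂ hB₂ hX₂
  have h1 := connectivity_union_add_connectivity_delete_delete_le hef
    (h.coindep.of_subset (show {e, f} ⊆ D by grind)) hf₁ he₂
  have hNm : N ≤m M ＼ {e} ＼ {f} := by
    have := IsMinor.of_subset_subset (M := M) (empty_subset C) (show {e} ∪ {f} ⊆ D by grind)
      h.disjoint
    rwa [contract_empty, h.contract_delete_eq, ← delete_delete] at this
  have h2 := hNm.connectivity_le (X₁ ∩ X₂)
  rw [h.connectivity_eq (subset_inter hA₁ hA₂) (hB₁.mono_left inter_subset_left)] at h2
  exact h.not_separates
    ⟨X₁ ∪ X₂, hA₁.trans subset_union_left, disjoint_union_left.2 ⟨hB₁, hB₂⟩, by linarith⟩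

/-- The same uncrossing, now between `M ＼ e` and `M ／ f`. -/
lemma mem_closure_or_mem_dual_closure (h : IsMinimalFailure 𝓜 N k A B M C D) (he : e ∈ D)
    (hf : f ∈ C) : e ∈ M.closure (B ∪ C) ∨ f ∈ M✶.closure (B ∪ D) := by
  by_contra! hcl
  have := h.finite
  have hD : D ⊆ M.E := h.coindep.subset_ground
  have hC := h.indep.subset_ground
  have hef : e ≠ f := by
    rintro rfl
    exact h.disjoint.notMem_of_mem_left hf he
  have hminor := fun {C' D'} (h1 : C' ⊆ C) (h2 : D' ⊆ D) ↦
    h.contract_delete_eq ▸ IsMinor.of_subset_subset (M := M) h1 h2 h.disjoint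
  obtain ⟨X₁, hA₁, hB₁, hX₁⟩ : (M ＼ {e}).Separates k A B := by
    refine h.separates_of_isMinor (delete_isMinor M {e}) (hD he) (by simp) ?_
    simpa using hminor (empty_subset C) (show {e} ⊆ D by simpa)
  obtain ⟨X₂, hA₂, hB₂, hX₂⟩ : (M ／ {f}).Separates k A B := by
    refine h.separates_of_isMinor (contract_isMinor M {f}) (hC hf)
      (by simp) ?_
    simpa using hminor (show {f} ⊆ C by simpa) (empty_subset D)
  have hf₁ : f ∈ X₁ := by
    refine h.mem_of_notMem_dual_closure hf hcl.2 ?_ inferInstance hA₁ hB₁ hX₁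
    simpa using IsMinor.of_subset_subset (M := M) (empty_subset (C \ {f})) (show {e} ⊆ D by simpa)
      (h.disjoint.mono_left sdiff_subset)
  have he₂ : e ∈ X₂ := by
    refine h.mem_of_notMem_closure he hcl.1 ?_ inferInstance hA₂ hB₂ hX₂
    simpa using IsMinor.of_subset_subset (M := M) (show {f} ⊆ C by simpa) (empty_subset (D \ {e}))
      (h.disjoint.mono_right sdiff_subset)
  have h1 := connectivity_union_add_connectivity_delete_contract_le hef
    (h.coindep.of_subset (show {e} ⊆ D by simpa)) (h.indep.subset (show {f} ⊆ C by simpa)) hf₁ he₂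
  have h2 := (hminor (show {f} ⊆ C by simpa) (show {e} ⊆ D by simpa)).connectivity_le (X₁ ∩ X₂)
  rw [h.connectivity_eq (subset_inter hA₁ hA₂) (hB₁.mono_left inter_subset_left)] at h2
  exact h.not_separates
    ⟨X₁ ∪ X₂, hA₁.trans subset_union_left, disjoint_union_left.2 ⟨hB₁, hB₂⟩, by linarith⟩

/-- An element of `D` cannot be spanned by `C`, since otherwise both its deletion and its
contraction keep `N`. -/
lemma notMem_closure (h : IsMinimalFailure 𝓜 N k A B M C D) (he : e ∈ D) :
    e ∉ M.closure C := by
  intro hecl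
  have := h.finite
  have hD : D ⊆ M.E := h.coindep.subset_ground
  have hCD := h.disjoint
  have hNe : N ≤m M ／ {e} := by
    have h1 : (M ／ C ＼ (D \ {e})) ／ {e} = N := by
      rw [contract_eq_delete_of_subset_loops, delete_delete, sdiff_union_of_subset (by simpa),
        h.contract_delete_eq]
      rw [singleton_subset_iff, ← isLoop_iff, delete_isLoop_iff, contract_isLoop_iff_mem_closure]
      exact ⟨⟨hecl, hCD.notMem_of_mem_right he⟩, by simp⟩
    rw [← h1, contract_delete_contract _ _ _ _ (by simp), union_comm,
      ← contract_contract]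
    exact contract_delete_isMinor ..
  obtain ⟨X₁, hA₁, hB₁, hX₁⟩ : (M ＼ {e}).Separates k A B := by
    refine h.separates_of_isMinor (delete_isMinor M {e}) (hD he) (by simp) ?_
    simpa [h.contract_delete_eq] using
      IsMinor.of_subset_subset (M := M) (empty_subset C) (show {e} ⊆ D by simpa) hCD
  obtain ⟨X₂, hA₂, hB₂, hX₂⟩ : (M ／ {e}).Separates k A B :=
    h.separates_of_isMinor (contract_isMinor M {e}) (hD he) (by simp) hNe
  have h1 := connectivity_inter_add_connectivity_insert_union_le (hD he) X₁ X₂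
  have hE := h.mem_ground_iff
  have heA : e ∉ A := by grind
  have heB : e ∉ B := by grind
  -- The two connectivities sum to at most `2(k - 1) + 1`, so one of them is at most `k - 1`.
  by_cases h2 : M.connectivity ((X₁ ∩ X₂) \ {e}) ≤ (k : ℤ) - 1
  · exact h.not_separates ⟨_, by grind, by grind, h2⟩
  · refine h.not_separates ⟨_, (hA₁.trans subset_union_left).trans (subset_insert _ _), ?_,
      show M.connectivity (insert e (X₁ ∪ X₂)) ≤ (k : ℤ) - 1 by linarith⟩
    grind

/-- The contracted set `C` splits into a part `F` free over `B` and a part `S` free over `A`; then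
the deleted set cannot be spanned by `B ∪ S`. -/
lemma exists_notMem_closure (h : IsMinimalFailure 𝓜 N k A B M C D) (hSF : S ∪ F = C)
    (hdj : Disjoint S F) (hS : ∀ c ∈ S, c ∉ M.closure (A ∪ (C \ {c})))
    (hF : ∀ c ∈ F, c ∉ M.closure (B ∪ (C \ {c}))) : ∃ e ∈ D, e ∉ M.closure (B ∪ S) := by
  by_contra! hcon
  subst hSF
  have := h.finite
  have hE := h.mem_ground_iff
  have hC := h.indep.subset_ground
  have hD : D ⊆ M.E := h.coindep.subset_ground
  have hCD := h.disjoint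
  have hAB := h.isInducer.disjoint
  have h1 := rk_union_eq_add_ncard (M := M) (S := S) (Z := A ∪ F) (subset_union_left.trans hC)
    fun c hc hc' ↦ hS c hc (M.closure_subset_closure (by grind) hc')
  have h2 := rk_union_eq_add_ncard (M := M) (S := F) (Z := B ∪ S) (subset_union_right.trans hC)
    fun c hc hc' ↦ hF c hc (M.closure_subset_closure (by grind) hc')
  have h3 := rk_union_of_subset_closure hcon
  have h4 := h.rk_eq
  rw [ncard_union_eq hdj (M.ground_finite.subset (subset_union_left.trans hC))
    (M.ground_finite.subset (subset_union_right.trans hC)),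
    show A ∪ (S ∪ F) = A ∪ F ∪ S by grind, ← union_assoc] at h4
  push_cast at h4
  -- Against `rk_eq`, the side `A ∪ F` loses rank `|S|` and the side `B ∪ S ∪ D` loses `|F|`;
  -- together these are the `|C|` in that identity.
  refine h.not_separates ⟨A ∪ F, subset_union_left, by grind, ?_⟩
  rw [connectivity_eq_rk, show M.E \ (A ∪ F) = B ∪ S ∪ D by grind]
  linarith

end IsMinimalFailure

end Matroid

namespace Matroid

variable {α : Type*} {M N : Matroid α} {C D A B : Set α} {e f : α} {k : ℕ}
  {𝓜 : Set (Matroid α)}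

/-! ### The contradiction in a minimal failure. -/

namespace IsMinimalFailure

lemma exists_isTriad (h : IsMinimalFailure 𝓜 N k A B M C D) (he : e ∈ D) (hf : f ∈ C)
    (heB : e ∈ M.closure (B ∪ C)) (heB' : e ∉ M.closure (B ∪ (C \ {f})))
    (hfA : f ∈ M.closure (A ∪ (C \ {f}))) :
    ∃ g ∈ A, (M ／ (C \ {f}) ＼ (D \ {e})).IsTriad {e, f, g} := by
  have := h.finite
  have hE := h.mem_ground_iff
  have hC := h.indep.subset_ground
  have hD : D ⊆ M.E := h.coindep.subset_ground
  have hCD := h.disjoint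
  have hef : e ≠ f := by
    rintro rfl
    exact hCD.notMem_of_mem_left hf he
  have hCf : insert f (C \ {f}) = C := by simp [hf]
  have hdj : Disjoint (C \ {f}) (D \ {e}) :=
    (hCD.mono_left sdiff_subset).mono_right sdiff_subset
  have hfD : f ∉ D \ {e} := by grind
  refine h.isInducer.exists_isTriad (h.isInducer.minor _ h.mem _ (contract_delete_isMinor ..)) hef
    (by simp; grind) (by simp; grind) ?_ ?_ ?_ ?_ ?_ ?_ ?_
  · have h1 := contract_delete_sdiff_sdiff (M := M) (C := C) (D := D)
      (sdiff_subset : C \ {f} ⊆ C) (sdiff_subset : D \ {e} ⊆ D) hCD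
    rwa [sdiff_sdiff_cancel_left (by simpa), sdiff_sdiff_cancel_left (by simpa),
      h.contract_delete_eq] at h1
  · rw [isLoop_iff, loops, mem_closure_contract_delete_iff (by simp) hfD (by simp), empty_union]
    exact h.indep.notMem_closure_sdiff_of_mem hf
  · rw [← dual_isLoop_iff_isColoop, contract_delete_comm _ hdj, dual_delete_contract, isLoop_iff,
      loops, mem_closure_contract_delete_iff (by simp) (by grind) (by simp), empty_union]
    exact h.coindep.indep.notMem_closure_sdiff_of_mem he
  · rwa [mem_closure_contract_delete_iff (by grind) (by simp) (by grind), insert_union,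
      ← union_insert, hCf]
  · rwa [mem_closure_contract_delete_iff (by grind) (by simp) (by grind)]
  · rwa [mem_closure_contract_delete_iff (by simp) hfD (by grind)]
  · rw [mem_closure_contract_delete_iff (by grind) (by simp) (by simpa using hfD), singleton_union,
      hCf]
    exact h.notMem_closure he

/-- Since `f` and `g` are in series once `D` is deleted, contracting `g` in place of `f` gives a
copy of `N` in `M ／ g`, to which minimality applies. -/
lemma false_of_isTriad (h : IsMinimalFailure 𝓜 N k A B M C D) (he : e ∈ D) (hf : f ∈ C)
    (hD : ∀ e ∈ D, e ∈ M.closure (B ∪ C)) {g : α} (hg : g ∈ A)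
    (hT : (M ／ (C \ {f}) ＼ (D \ {e})).IsTriad {e, f, g}) : False := by
  classical
  have := h.finite
  have hE := h.mem_ground_iff
  have hAB := h.isInducer.disjoint
  have hCD := h.disjoint
  have hgE : g ∈ M.E := by grind
  have hgf : f ≠ g := by grind
  have hcoc : (M ／ (C \ {f}) ＼ D).IsCocircuit {f, g} := by
    have h1 := hT.1.delete_isCocircuit (D := {e}) ⟨by simp, by grind⟩
    rwa [delete_delete, sdiff_union_of_subset (by simpa),
      show ({e, f, g} : Set α) \ {e} = {f, g} by grind] at h1
  have hN : N.mapEquiv (Equiv.swap f g) = M ／ (C \ {f}) ＼ D ／ {g} := by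
    rw [← contract_mapEquiv_swap_eq_of_isCocircuit hcoc hgf,
      contract_delete_contract _ _ _ _ (by grind), sdiff_union_of_subset (by simpa),
      h.contract_delete_eq]
  have hmin : N.mapEquiv (Equiv.swap f g) ≤m M ／ {g} := by
    rw [hN, contract_delete_contract _ _ _ _ (by grind), union_comm, ← contract_contract]
    exact contract_delete_isMinor ..
  obtain ⟨X, hAX, hBX, hX⟩ := h.separates_of_lt (M ／ {g})
    (h.isInducer.minor _ h.mem _ (contract_isMinor ..))
    (ncard_lt_ncard (by simpa using hgE) M.ground_finite) _ hmin
  rw [image_swap_eq_self (by grind) (by grind)] at hBX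
  have hAX' : A \ {g} ⊆ X := by
    rw [← image_swap_eq_self (e := f) (f := g) (X := A \ {g}) (by grind) (by simp)]
    exact (image_mono sdiff_subset).trans hAX
  have hX' : (k : ℤ) - 1 < M.connectivity (insert g X) := by
    by_contra! hle
    exact h.not_separates ⟨_, by grind, by grind, hle⟩
  rw [connectivity_contract hgE] at hX
  rw [connectivity_eq_rk] at hX'
  have h1 := M.rk_singleton_le g
  have h2 : g ∈ M.closure (M.E \ insert g X) := by
    -- Returning `g` to the side of `A` raises the connectivity above `k - 1` only if the other side
    -- spans `g`.
    refine mem_closure_of_rk_insert_le hgE ?_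
    rw [show insert g (M.E \ insert g X) = insert g (M.E \ X) by grind]
    linarith
  refine h.isInducer.notMem_closure hg ?_
  rw [← h.contract_delete_eq, mem_closure_contract_delete_iff (by grind) (by grind) (by grind)]
  -- As `A \ g ⊆ X`, the other side lies in `B ∪ C ∪ D`, all spanned by `B ∪ C`.
  refine M.closure_subset_closure_of_subset_closure (fun x hx ↦ ?_) h2
  by_cases hxD : x ∈ D
  · exact hD x hxD
  · exact M.mem_closure_of_mem' (by grind) hx.1

lemma false_of_forall_mem_closure (h : IsMinimalFailure 𝓜 N k A B M C D)
    (hD : ∀ e ∈ D, e ∈ M.closure (B ∪ C))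
    (hC : ∀ c ∈ C, ∀ f ∈ C, c ∈ M.closure (A ∪ (C \ {c})) → f ∈ M.closure (A ∪ (C \ {f})) →
      c = f) : False := by
  have := h.finite
  have hE := h.mem_ground_iff
  have hCD := h.disjoint
  by_cases hf : ∃ f ∈ C, f ∈ M.closure (A ∪ (C \ {f}))
  · obtain ⟨f, hf, hfA⟩ := hf
    have hfB : f ∉ M.closure (B ∪ (C \ {f})) := by
      have h1 := h.isInducer.notMem_closure_right (P := M ／ (C \ {f}) ＼ D) (f := f)
        (h.isInducer.minor _ h.mem _ (contract_delete_isMinor ..))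
        ⟨⟨h.indep.subset_ground hf, by simp⟩, hCD.notMem_of_mem_left hf⟩
        (by rw [contract_delete_contract _ _ _ _ (by grind), sdiff_union_of_subset (by simpa),
              h.contract_delete_eq])
      rw [isLoop_iff, loops, mem_closure_contract_delete_iff (by simp) (by grind) (by simp),
        mem_closure_contract_delete_iff (by simp) (by grind) (by grind),
        mem_closure_contract_delete_iff (by simp) (by grind) (by grind), empty_union] at h1
      exact h1 (h.indep.notMem_closure_sdiff_of_mem hf) hfA
    obtain ⟨e, he, heB⟩ := h.exists_notMem_closure (S := C \ {f}) (F := {f})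
      (sdiff_union_of_subset (by simpa)) disjoint_sdiff_left
      (fun c hc hcA ↦ hc.2 (hC c hc.1 f hf hcA hfA)) (by simpa using hfB)
    obtain ⟨g, hg, hT⟩ := h.exists_isTriad he hf (hD e he) heB hfA
    exact h.false_of_isTriad he hf hD hg hT
  · push Not at hf
    obtain ⟨e, he, heB⟩ := h.exists_notMem_closure (S := C) (F := ∅) (by simp) (by simp) hf
      (by simp)
    exact heB (hD e he)

lemma false (h : IsMinimalFailure 𝓜 N k A B M C D) : False := by
  have := h.finite
  have hE := h.mem_ground_iff
  have hCE := h.indep.subset_ground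
  have hDE : D ⊆ M.E := h.coindep.subset_ground
  have hCD := h.disjoint
  have hAB := h.isInducer.disjoint
  have hdualC : ∀ c ∈ C, c ∈ M✶.closure (B ∪ D) ↔ c ∉ M.closure (A ∪ (C \ {c})) := by
    intro c hc
    rw [mem_closure_dual_iff (hCE hc) (by grind) (by grind),
      show M.E \ insert c (B ∪ D) = A ∪ (C \ {c}) by grind]
  have hdualD : ∀ d ∈ D, d ∈ M✶.closure (A ∪ (D \ {d})) ↔ d ∉ M.closure (B ∪ C) := by
    intro d hd
    rw [mem_closure_dual_iff (hDE hd) (by grind) (by grind),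
      show M.E \ insert d (A ∪ (D \ {d})) = B ∪ C by grind]
  -- If this fails for some `e`, then every `f ∈ C` is in the dual closure of `B ∪ D`, which is the
  -- same hypothesis for `M✶`.
  by_cases hD : ∀ e ∈ D, e ∈ M.closure (B ∪ C)
  · refine h.false_of_forall_mem_closure hD fun c hc f hf hcA hfA ↦ ?_
    exact h.dual.eq_of_notMem_closure hc hf (by rw [hdualC c hc]; simpa)
      (by rw [hdualC f hf]; simpa)
  · push Not at hD
    obtain ⟨e, he, heB⟩ := hD
    refine h.dual.false_of_forall_mem_closure
      (fun f hf ↦ (h.mem_closure_or_mem_dual_closure he hf).resolve_left heB)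
      fun c hc d hd hcA hdA ↦ ?_
    exact h.eq_of_notMem_closure hc hd ((hdualD c hc).1 hcA) ((hdualD d hd).1 hdA)

end IsMinimalFailure

/-! ### Induction on the size of `M`, and passage to exact separations. -/

lemma IsInducer.separates (h : IsInducer 𝓜 N k A B)
    (hiso : ∀ M ∈ 𝓜, ∀ σ : Equiv.Perm α, M.mapEquiv σ ∈ 𝓜) (hM : M ∈ 𝓜) (σ : Equiv.Perm α)
    (hNM : N.mapEquiv σ ≤m M) : M.Separates k (σ '' A) (σ '' B) := by
  -- The relabelling must vary too: the series swap appeals to a different copy of `N`.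
  induction hn : M.E.ncard using Nat.strong_induction_on generalizing M σ with
  | _ n ih =>
    have hmin : N ≤m M.mapEquiv σ.symm := by
      simpa [mapEquiv_mapEquiv_symm] using hNM.mapEquiv σ.symm
    have hsep : (M.mapEquiv σ.symm).Separates k A B := by
      by_contra hcon
      obtain ⟨C, D, hC, hD, hdj, hCD⟩ := hmin.exists_indep_coindep
      refine IsMinimalFailure.false (𝓜 := 𝓜) (N := N) (k := k) (A := A) (B := B)
        ⟨h, hiso M hM _, hCD, hC, hD, hdj, fun M₁ hM₁ hlt τ hτ ↦ ih _ ?_ hM₁ τ hτ rfl, hcon⟩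
      rwa [mapEquiv_ground_eq, ncard_image_of_injective _ σ.symm.injective, hn] at hlt
    obtain ⟨X, hA, hB, hX⟩ := hsep
    refine ⟨σ '' X, image_mono hA, (disjoint_image_iff σ.injective).2 hB, ?_⟩
    rw [← connectivity_mapEquiv _ σ.symm, Equiv.symm_image_image]
    exact hX

lemma IsExactSeparation.exists_of_separates [M.Finite] (h : N.IsExactSeparation k A B)
    {σ : Equiv.Perm α} (hNM : N.mapEquiv σ ≤m M) (hM : M.Separates k (σ '' A) (σ '' B)) :
    ∃ X Y, M.IsExactSeparation k X Y ∧ σ '' A ⊆ X ∧ σ '' B ⊆ Y := by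
  obtain ⟨X, hA, hB, hX⟩ := hM
  have hE : σ '' A ∪ σ '' B ⊆ M.E := by
    rw [← image_union, h.union_eq]
    exact hNM.subset
  have hA' : σ '' A ⊆ X ∩ M.E := subset_inter hA (subset_union_left.trans hE)
  have hB' : σ '' B ⊆ M.E \ X := subset_sdiff.2 ⟨subset_union_right.trans hE, hB.symm⟩
  refine ⟨X ∩ M.E, M.E \ X, ⟨h.one_le, by grind, by grind, ?_, ?_, ?_⟩, hA', hB'⟩
  · exact h.le_left.trans ((ncard_image_of_injective A σ.injective).symm.trans_le
      (ncard_le_ncard hA' (M.ground_finite.subset inter_subset_right)))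
  · exact h.le_right.trans ((ncard_image_of_injective B σ.injective).symm.trans_le
      (ncard_le_ncard hB' (M.ground_finite.subset sdiff_subset)))
  · rw [connectivity_congr (show X ∩ M.E ∩ M.E = X ∩ M.E by grind)]
    -- Connectivity does not increase in minors, so the copy of `N` supplies the lower bound `k -
    -- 1`.
    refine le_antisymm hX ?_
    rw [← h.connectivity_eq, ← connectivity_mapEquiv N σ,
      connectivity_congr (M := N.mapEquiv σ) (X := σ '' A) (Y := X)]
    · exact hNM.connectivity_le X
    · rw [mapEquiv_ground_eq, ← h.union_eq, image_union]
      grind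

end Matroid

theorem theorem2p2 {α : Type*} (𝓜 : Set (Matroid α)) (h𝓜 : Matroid.IsClosedClass 𝓜)
    (N : Matroid α) (hN : N ∈ 𝓜) (hNs : N.IsSimple) (hNc : N.IsCosimple)
    (k : ℕ) (A B : Set α) (hAB : N.IsExactSeparation k A B)
    (hAcirc : N.IsUnionOfCircuits A) (hAcocirc : N.IsUnionOfCocircuits A)
    (h_i : ∀ M ∈ 𝓜, ∀ e : α, M.IsSimpleExtension N e →
      ∃ C, M.IsCircuit C ∧ e ∈ C ∧ (C ⊆ A ∪ {e} ∨ C ⊆ B ∪ {e}))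
    (h_ii : ∀ M ∈ 𝓜, ∀ f : α, M.IsCosimpleCoextension N f →
      ∃ D, M.IsCocircuit D ∧ f ∈ D ∧ (D ⊆ A ∪ {f} ∨ D ⊆ B ∪ {f}))
    (h_iii : ∀ M ∈ 𝓜, ∀ e f : α, M.IsTwoElementExpansion N e f →
      ∀ R : Set α, {e, f} ⊆ R → R ⊆ B ∪ {e, f} →
        (M.IsCircuit R →
          (∃ D, M.IsCocircuit D ∧ f ∈ D ∧ D ⊆ B ∪ {e, f}) ∨ ∃ g ∈ A, M.IsTriad {e, f, g}) ∧
        (M.IsCocircuit R →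
          (∃ C, M.IsCircuit C ∧ e ∈ C ∧ C ⊆ B ∪ {e, f}) ∨ ∃ g ∈ A, M.IsTriangle {e, f, g})) :
    ∀ M ∈ 𝓜, M.HasMinorCopy N → N.IsDecomposer k A B M := by
  intro M hM _ φ hφ hNM
  have hfin : M.Finite := ⟨h𝓜.finite M hM⟩
  -- Finiteness of `E(N)` lets the injection extend to a permutation of the whole type.
  obtain ⟨σ, hσ⟩ := hφ.exists_perm_eqOn (h𝓜.finite N hN)
  have hind : Matroid.IsInducer 𝓜 N k A B :=
    ⟨fun M hM ↦ ⟨h𝓜.finite M hM⟩, h𝓜.minor, hN, hNs, hNc, hAB, hAcirc, hAcocirc, h_i, h_ii,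
      h_iii⟩
  rw [Matroid.map_eq_mapEquiv hφ σ hσ] at hNM
  have hsep := hind.separates (fun M hM σ ↦ h𝓜.iso M hM σ σ.injective.injOn) hM σ hNM
  have himg : ∀ Z ⊆ N.E, φ '' Z = σ '' Z := fun Z hZ ↦
    image_congr fun x hx ↦ (hσ x (hZ hx)).symm
  rw [himg A (hAB.union_eq ▸ subset_union_left), himg B (hAB.union_eq ▸ subset_union_right)]
  exact hAB.exists_of_separates hNM hsep
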